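/- Let $\mathsf B$ be a complete Boolean algebra, let $\kappa$ be an infinite cardinal with $|\mathsf B|\le\kappa$, and let $\lambda$ be a regular (infinite) cardinal. Regard $\mathsf B$, up to isomorphism, as an algebra whose underlying set is a subset of $\kappa$. Let $V^{\mathsf B}$ be the class of $\mathsf B$-names, $\mathcal C = V^{\mathsf B}\cap H_{\kappa^+}$ the set of $\mathsf B$-names hereditarily of size at most $\kappa$, and $\mathrm L(\mathcal C)_{\lambda\omega}$ the infinitary logic in the signature $\{\in\}\cup\mathcal C$ with conjunctions and disjunctions of size $<\lambda$ and quantification over finite strings of variables. For a sentence $\phi$ let $[\![\phi^{H_{\check\kappa^+}}]\!]_{\mathsf B}\in\mathsf B$ be its Boolean value in $V^{\mathsf B}$ with all quantifiers of $\phi$ restricted to $H_{\check\kappa^+}$ (the sets contained in a transitive set of cardinality at most $|\check\kappa|$, as computed in $V^{\mathsf B}$). A set $S$ of sets of sentences is a consistency property, over the infinite set of constants $\mathcal C$, if for all $s\in S$: * (Con) for no sentence $\phi$ are both $\phi$ and $\neg\phi$ in $s$; * (Ind.1) if $\neg\phi\in s$, then $s\cup\{\phi\neg\}\in S$, where $\phi\neg$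 is obtained by moving the negation one step inside ($\phi\neg=\neg\phi$ for atomic $\phi$, $(\neg\phi)\neg=\phi$, $(\bigwedge\Phi)\neg=\bigvee_{\phi\in\Phi}\neg\phi$, $(\bigvee\Phi)\neg=\bigwedge_{\phi\in\Phi}\neg\phi$, $(\forall\vec v\,\phi)\neg=\exists\vec v\,\neg\phi$, $(\exists\vec v\,\phi)\neg=\forall\vec v\,\neg\phi$); * (Ind.2) if $\bigwedge\Phi\in s$, then $s\cup\{\phi\}\in S$ for all $\phi\in\Phi$; * (Ind.3) if $\forall\vec v\,\phi(\vec v)\in s$, then $s\cup\{\phi(\vec c)\}\in S$ for all strings $\vec c$ from $\mathcal C$; * (Ind.4) if $\bigvee\Phi\in s$, then $s\cup\{\phi\}\in S$ for some $\phi\in\Phi$; * (Ind.5) if $\exists\vec v\,\phi(\vec v)\in s$, then $s\cup\{\phi(\vec c)\}\in S$ for some string $\vec c$ from $\mathcal C$; * (Str.1) if $(c=d)\in s$ with $c,d\in\mathcal C$, then $s\cup\{d=c\}\in S$; * (Str.2) if $(c=d)\in s$ and $\phi(d)\in s$ with $c,d\in\mathcal C$, then $s\cup\{\phi(c)\}\in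 S$; * (Str.3) for all $d\in\mathcal C$ there is $c\in\mathcal C$ with $s\cup\{c=d\}\in S$. Then: 1. The family $$S_{\mathsf B}=\Bigl\{s : s \text{ is a finite set of } \mathrm L(\mathcal C)_{\lambda\omega}\text{-sentences with } \bigl[\!\bigl[(\textstyle\bigwedge s)^{H_{\check\kappa^+}}\bigr]\!\bigr]_{\mathsf B}>0_{\mathsf B}\Bigr\}$$ is a consistency property. 2. Order $S_{\mathsf B}$ by reverse inclusion, and let $\mathsf B^+=\mathsf B\setminus\{0_{\mathsf B}\}$ have the order of $\mathsf B$. The map $\pi_{\mathsf B}\colon S_{\mathsf B}\to\mathsf B^+$, $s\mapsto[\![(\bigwedge s)^{H_{\check\kappa^+}}]\!]_{\mathsf B}$, is a dense embedding: it is order preserving, $s\perp t$ if and only if $\pi_{\mathsf B}(s)\perp\pi_{\mathsf B}(t)$, and its image is dense in $\mathsf B^+$. In particular $\mathsf B^+$ and $S_{\mathsf B}$ are equivalent forcing notions, that is, their Boolean completions are isomorphic. Hence every forcing notion $\mathbb P$ is forcing-equivalent to a consistency property: for every regular $\lambda$ there are a complete Boolean algebra $\mathsf B$ and an infinite cardinal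 $\kappa\ge|\mathsf B|$ such that $\mathbb P$ is forcing-equivalent to the consistency property $S_{\mathsf B}$ formed with $\kappa$ and $\lambda$. -/

import Mathlib

open Cardinal

universe u

namespace ForcingConsistency

noncomputable section

/-! ### Infinitary formulas in the signature `{∈}` with additional constants -/

/-- Terms: constants from `C`, or one of the `n` free variables. -/
inductive Tm (C : Type (u + 1)) (n : ℕ) : Type (u + 1)
  | const (c : C) : Tm C n
  | var (i : Fin n) : Tm C n

/-- `Fml C n` consists of the formulas of the logic `L(C)_{∞ω}`, for `L = {∈}` and `C` a collection
of constants, with free variables among `v_0, …, v_{n-1}`. Conjunctions and disjunctions are taken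
over sets of formulas listed by an arbitrary ordinal `o`, all of them in the same finitely many free
variables. Quantifiers bind finite strings of variables: in `all m φ` and `ex m φ` the first `m`
variables of `φ` are bound. -/
inductive Fml (C : Type (u + 1)) : ℕ → Type (u + 1)
  | mem {n : ℕ} (s t : Tm C n) : Fml C n
  | eq {n : ℕ} (s t : Tm C n) : Fml C n
  | neg {n : ℕ} (φ : Fml C n) : Fml C n
  | conj {n : ℕ} (o : Ordinal.{u}) (Φ : o.ToType → Fml C n) : Fml C n
  | disj {n : ℕ} (o : Ordinal.{u}) (Φ : o.ToType → Fml C n) : Fml C n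
  | all {n : ℕ} (m : ℕ) (φ : Fml C (m + n)) : Fml C n
  | ex {n : ℕ} (m : ℕ) (φ : Fml C (m + n)) : Fml C n

/-- Sentences of `L(C)_{∞ω}`. -/
abbrev Sentence (C : Type (u + 1)) : Type (u + 1) := Fml C 0

namespace Tm

variable {C : Type (u + 1)}

/-- Simultaneous substitution of terms for variables in a term. -/
def subst {n k : ℕ} (σ : Fin n → Tm C k) : Tm C n → Tm C k
  | const c => const c
  | var i => σ i

/-- Make room for `m` new variables in front. -/
def shift {k : ℕ} (m : ℕ) : Tm C k → Tm C (m + k) :=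
  subst (fun i => var (Fin.natAdd m i))

/-- Extend a substitution below a quantifier that binds `m` variables. -/
def liftSubst {n k : ℕ} (m : ℕ) (σ : Fin n → Tm C k) : Fin (m + n) → Tm C (m + k) :=
  Fin.addCases (fun i => var (Fin.castAdd k i)) (fun j => shift m (σ j))

end Tm

namespace Fml

variable {C : Type (u + 1)}

/-- Simultaneous (capture avoiding) substitution of terms for the free variables. -/
def subst : {n : ℕ} → Fml C n → {k : ℕ} → (Fin n → Tm C k) → Fml C k
  | _, mem s t, _, σ => mem (s.subst σ) (t.subst σ)
  | _, eq s t, _, σ => eq (s.subst σ) (t.subst σ)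
  | _, neg φ, _, σ => neg (φ.subst σ)
  | _, conj o Φ, _, σ => conj o (fun i => (Φ i).subst σ)
  | _, disj o Φ, _, σ => disj o (fun i => (Φ i).subst σ)
  | _, all m φ, _, σ => all m (φ.subst (Tm.liftSubst m σ))
  | _, ex m φ, _, σ => ex m (φ.subst (Tm.liftSubst m σ))

/-- The sentence `φ(c_0, …, c_{n-1})`. -/
def inst {n : ℕ} (φ : Fml C n) (c : Fin n → C) : Sentence C :=
  φ.subst (fun i => Tm.const (c i))

/-- `φ¬`: moving a negation inside. -/
def negInside : {n : ℕ} → Fml C n → Fml C n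
  | _, mem s t => neg (mem s t)
  | _, eq s t => neg (eq s t)
  | _, neg φ => φ
  | _, conj o Φ => disj o (fun i => neg (Φ i))
  | _, disj o Φ => conj o (fun i => neg (Φ i))
  | _, all m φ => ex m (neg φ)
  | _, ex m φ => all m (neg φ)

/-- `φ` is a formula of `L(C)_{lam ω}`: all conjunctions and disjunctions have size less
than `lam`. -/
def InL (lam : Cardinal.{u}) : {n : ℕ} → Fml C n → Prop
  | _, mem _ _ => True
  | _, eq _ _ => True
  | _, neg φ => InL lam φ
  | _, conj o Φ => o.card < lam ∧ ∀ i, InL lam (Φ i)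
  | _, disj o Φ => o.card < lam ∧ ∀ i, InL lam (Φ i)
  | _, all _ φ => InL lam φ
  | _, ex _ φ => InL lam φ

end Fml

/-! ### Consistency properties -/

/-- `S` is a consistency property for `L(C)_{∞ω}`, where `L = {∈}` has no constants of its own.
A set is, as usual, a `Small` collection. -/
structure IsConsistencyProperty {C : Type (u + 1)} (S : Set (Set (Sentence C))) : Prop where
  small_constants : Small.{u} C
  infinite_constants : Infinite C
  small : Small.{u} S
  small_mem : ∀ s ∈ S, Small.{u} s
  con : ∀ r ∈ S, ∀ φ : Sentence C, φ ∉ r ∨ Fml.neg φ ∉ r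
  ind1 : ∀ s ∈ S, ∀ φ : Sentence C, Fml.neg φ ∈ s → s ∪ {φ.negInside} ∈ S
  ind2 : ∀ s ∈ S, ∀ (o : Ordinal.{u}) (Φ : o.ToType → Sentence C), Fml.conj o Φ ∈ s →
    ∀ i, s ∪ {Φ i} ∈ S
  ind3 : ∀ s ∈ S, ∀ (m : ℕ) (φ : Fml C m), Fml.all (n := 0) m φ ∈ s →
    ∀ c : Fin m → C, s ∪ {φ.inst c} ∈ S
  ind4 : ∀ s ∈ S, ∀ (o : Ordinal.{u}) (Φ : o.ToType → Sentence C), Fml.disj o Φ ∈ s →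
    ∃ i, s ∪ {Φ i} ∈ S
  ind5 : ∀ s ∈ S, ∀ (m : ℕ) (φ : Fml C m), Fml.ex (n := 0) m φ ∈ s →
    ∃ c : Fin m → C, s ∪ {φ.inst c} ∈ S
  str1 : ∀ s ∈ S, ∀ c d : C, Fml.eq (Tm.const c) (Tm.const d) ∈ s →
    s ∪ {Fml.eq (Tm.const d) (Tm.const c)} ∈ S
  str2 : ∀ s ∈ S, ∀ (c d : C) (φ : Fml C 1), Fml.eq (Tm.const c) (Tm.const d) ∈ s →
    φ.inst (fun _ => d) ∈ s → s ∪ {φ.inst (fun _ => c)} ∈ S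
  str3 : ∀ s ∈ S, ∀ d : C, ∃ c : C, s ∪ {Fml.eq (Tm.const c) (Tm.const d)} ∈ S

/-! ### The Boolean valued universe -/

/-- The class `V^B` of `B`-names: a name is a set of pairs `(τ, b)` with `τ` a name and `b ∈ B`;
such a set is given by a listing `(A i, b i)`, `i < o`, of its elements. -/
inductive BName (B : Type u) : Type (u + 1)
  | mk (o : Ordinal.{u}) (A : o.ToType → BName B) (b : o.ToType → B) : BName B

namespace BName

/-- The name is hereditarily of size at most `κ`. Here `B` is regarded as a Boolean algebra on a
subset of `κ`, so that these are the names in `V^B ∩ H_{κ⁺}`. -/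
def HereditarilyLE {B : Type u} (κ : Cardinal.{u}) : BName B → Prop
  | mk o A _ => o.card ≤ κ ∧ ∀ i, HereditarilyLE κ (A i)

variable {B : Type u} [CompleteBooleanAlgebra B]

/-- The canonical name `α̌` of an ordinal `α`, that is, `{(β̌, 1) : β < α}`. -/
def check (B : Type u) [CompleteBooleanAlgebra B] (α : Ordinal.{u}) : BName B :=
  mk α (fun i => check B (Ordinal.ToType.toOrd i).1) (fun _ => ⊤)
termination_by α
decreasing_by exact (Ordinal.ToType.toOrd i).2

/-- The Boolean value `⟦x = y⟧`. -/
def eqVal : BName B → BName B → B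
  | mk _ A b, mk _ A' b' =>
    (⨅ i, b i ⇨ ⨆ j, b' j ⊓ eqVal (A i) (A' j)) ⊓ (⨅ j, b' j ⇨ ⨆ i, b i ⊓ eqVal (A i) (A' j))

/-- The Boolean value `⟦x ∈ y⟧`. -/
def memVal (x : BName B) : BName B → B
  | mk _ A b => ⨆ i, b i ⊓ eqVal x (A i)

/-- `⟦x ⊆ y⟧` -/
def subsetVal (x y : BName B) : B := ⨅ z, memVal z x ⇨ memVal z y

/-- `⟦p = {x, y}⟧` -/
def pairVal (p x y : BName B) : B :=
  ⨅ z, (memVal z p ⇨ eqVal z x ⊔ eqVal z y) ⊓ (eqVal z x ⊔ eqVal z y ⇨ memVal z p)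

/-- `⟦p = (x, y)⟧`, for Kuratowski's ordered pair `{{x}, {x, y}}` -/
def orderedPairVal (p x y : BName B) : B :=
  ⨆ (a : BName B) (b : BName B), pairVal a x x ⊓ pairVal b x y ⊓ pairVal p a b

/-- `⟦(x, y) ∈ f⟧` -/
def pairMemVal (f x y : BName B) : B := ⨆ p, orderedPairVal p x y ⊓ memVal p f

/-- `⟦t is transitive⟧` -/
def transitiveVal (t : BName B) : B := ⨅ y, memVal y t ⇨ subsetVal y t

/-- `⟦|t| ≤ |k|⟧`: there is `f` that is single valued and under which every element of `t` is the
image of an element of `k`. -/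
def cardLEVal (t k : BName B) : B :=
  ⨆ f : BName B,
    (⨅ (x : BName B) (y : BName B) (z : BName B),
      pairMemVal f x y ⊓ pairMemVal f x z ⇨ eqVal y z) ⊓
    (⨅ y : BName B, memVal y t ⇨ ⨆ x : BName B, memVal x k ⊓ pairMemVal f x y)

/-- `⟦x ∈ H_{k⁺}⟧`: `x` is included in a transitive set of cardinality at most `|k|`. -/
def memHVal (k x : BName B) : B :=
  ⨆ t : BName B, transitiveVal t ⊓ subsetVal x t ⊓ cardLEVal t k

end BName

/-- Value of a term, for an interpretation `ι` of the constants and an assignment `v`. -/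
def Tm.val {C M : Type (u + 1)} (ι : C → M) {n : ℕ} (v : Fin n → M) : Tm C n → M
  | const c => ι c
  | var i => v i

/-- The Boolean value `⟦φ^H[v]⟧` in `V^B`, where all quantifiers of `φ` are restricted to the class
`H` whose membership `x ∈ H` has the Boolean value `H x`. The quantifiers range over all of `V^B`:
`∀ x⃗ φ` becomes `∀ x⃗ (x⃗ ∈ H → φ^H)` and `∃ x⃗ φ` becomes `∃ x⃗ (x⃗ ∈ H ∧ φ^H)`. -/
def Fml.relVal {B : Type u} [CompleteBooleanAlgebra B] {C : Type (u + 1)} (ι : C → BName B)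
    (H : BName B → B) : {n : ℕ} → Fml C n → (Fin n → BName B) → B
  | _, mem s t, v => BName.memVal (s.val ι v) (t.val ι v)
  | _, eq s t, v => BName.eqVal (s.val ι v) (t.val ι v)
  | _, neg φ, v => (φ.relVal ι H v)ᶜ
  | _, conj _ Φ, v => ⨅ i, (Φ i).relVal ι H v
  | _, disj _ Φ, v => ⨆ i, (Φ i).relVal ι H v
  | _, all m φ, v => ⨅ x : Fin m → BName B, (⨅ i, H (x i)) ⇨ φ.relVal ι H (Fin.append x v)
  | _, ex m φ, v => ⨆ x : Fin m → BName B, (⨅ i, H (x i)) ⊓ φ.relVal ι H (Fin.append x v)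

/-! ### The family `S_B` -/

/-- The constants: `V^B ∩ H_{κ⁺}`. -/
abbrev Names (B : Type u) (κ : Cardinal.{u}) : Type (u + 1) :=
  {τ : BName B // τ.HereditarilyLE κ}

/-- `⟦φ^{H_{κ̌⁺}}⟧` for a sentence `φ` with constants in `V^B ∩ H_{κ⁺}`. -/
def sentVal (B : Type u) [CompleteBooleanAlgebra B] (κ : Cardinal.{u})
    (φ : Sentence (Names B κ)) : B :=
  φ.relVal Subtype.val (BName.memHVal (BName.check B κ.ord)) Fin.elim0

/-- `⟦(⋀ s)^{H_{κ̌⁺}}⟧` for a set `s` of sentences. -/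
def conjVal (B : Type u) [CompleteBooleanAlgebra B] (κ : Cardinal.{u})
    (s : Set (Sentence (Names B κ))) : B :=
  ⨅ φ ∈ s, sentVal B κ φ

/-- `S_B`: the finite sets `s` of sentences of `L(C)_{lam ω}` with `⟦(⋀ s)^{H_{κ̌⁺}}⟧ > 0`. -/
def consistencyFamily (B : Type u) [CompleteBooleanAlgebra B] (κ lam : Cardinal.{u}) :
    Set (Set (Sentence (Names B κ))) :=
  {s | s.Finite ∧ (∀ φ ∈ s, φ.InL lam) ∧ ⊥ < conjVal B κ s}

/-! ### Forcing notions -/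

/-- The forcing notion given by a family `S` of sets: its conditions are the elements of `S`,
ordered by reverse inclusion. -/
def Cond {α : Type*} (S : Set (Set α)) : Type _ := {s : Set α // s ∈ S}

instance {α : Type*} (S : Set (Set α)) : PartialOrder (Cond S) where
  le s t := t.1 ⊆ s.1
  le_refl s := subset_rfl
  le_trans _ _ _ h h' := h'.trans h
  le_antisymm _ _ h h' := Subtype.ext (h'.antisymm h)

/-- The positive elements `B⁺`, with the order of `B`. -/
abbrev Pos (B : Type*) [CompleteBooleanAlgebra B] : Type _ := {b : B // ⊥ < b}

/-- Two conditions are incompatible. -/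
def Incompatible {P : Type*} [Preorder P] (p q : P) : Prop := ¬∃ r, r ≤ p ∧ r ≤ q

/-- Dense embeddings of forcing notions: maps that preserve the order, preserve compatibility and
incompatibility, and have a dense image. -/
structure IsDenseEmbedding {P Q : Type*} [Preorder P] [Preorder Q] (f : P → Q) : Prop where
  monotone : Monotone f
  incompatible_iff : ∀ p q, Incompatible p q ↔ Incompatible (f p) (f q)
  dense : ∀ q, ∃ p, f p ≤ q

/-- The Boolean completion `RO(P)` of a forcing notion: the regular open sets of the topology on `P`
whose open sets are the downward closed sets. (An element `U` of the Heyting algebra of open sets is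
regular if `Uᶜᶜ = U`, where `Uᶜ` is the interior of the complement.) -/
abbrev RO (P : Type*) [Preorder P] : Type _ := Heyting.Regular (LowerSet P)

/-- Two forcing notions are equivalent if they have isomorphic Boolean completions. -/
def ForcingEquivalent (P Q : Type*) [Preorder P] [Preorder Q] : Prop := Nonempty (RO P ≃o RO Q)

/-- The map `s ↦ ⟦(⋀ s)^{H_{κ̌⁺}}⟧` from `S_B` to `B⁺`. -/
def piMap (B : Type u) [CompleteBooleanAlgebra B] (κ lam : Cardinal.{u}) :
    Cond (consistencyFamily B κ lam) → Pos B :=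
  fun s => ⟨conjVal B κ s.1, s.2.2.2⟩

end

end ForcingConsistency

namespace ForcingConsistency

/-! The Boolean values make `V^B` a `B`-valued model, so each clause of a consistency property asks
for a nonzero element below both the value of `s` and the value of the added sentence. Most clauses
follow from Boolean algebra and the laws of equality (`relVal_congr`). The quantifier clauses need
the constants to represent `H_{κ̌⁺}`. For Ind.3, a name hereditarily of size at most `κ` lies in
`H_{κ̌⁺}` with value `⊤`, because its transitive closure can be listed along `κ`
(`HereditarilyLE.memHVal_eq_top`). For Ind.5, an element of `H_{κ̌⁺}` equals, below some nonzero
condition, such a small name (`exists_hereditarilyLE_eqVal`); here `#B ≤ κ` enters. A supremum above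
a nonzero element has a term that meets it, so no maximum principle is needed.

The map to `B⁺` turns unions into meets, which gives compatibility, and is onto because `∅ ∈ {(∅,
b)}` has value `b`. Dense embeddings induce isomorphisms of completions by preimage, and `P` embeds
densely in `RO(P)⁺`; hence `B = RO(P)` serves for an arbitrary `P`.

Throughout, `Γ ≤ ⟦φ⟧` is read as "`Γ` forces `φ`", and lemmas about such inequalities act as
introduction and elimination rules. -/

theorem le_of_le_iSup {B : Type*} [CompleteBooleanAlgebra B] {ι : Sort*} {f : ι → B} {Γ c : B}
    (h : Γ ≤ ⨆ i, f i) (H : ∀ i, Γ ⊓ f i ≤ c) : Γ ≤ c := by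
  have : Γ = ⨆ i, Γ ⊓ f i := by rw [← inf_iSup_eq]; exact (inf_eq_left.2 h).symm
  rw [this]; exact iSup_le H

theorem le_of_le_sup {B : Type*} [BooleanAlgebra B] {Γ a b c : B}
    (h : Γ ≤ a ⊔ b) (h₁ : Γ ⊓ a ≤ c) (h₂ : Γ ⊓ b ≤ c) : Γ ≤ c := by
  rw [← inf_eq_left.2 h, inf_sup_left]; exact sup_le h₁ h₂

theorem le_of_le_himp {B : Type*} [BooleanAlgebra B] {Γ a b : B}
    (h : Γ ≤ a ⇨ b) (h₁ : Γ ≤ a) : Γ ≤ b :=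
  (le_inf h h₁).trans himp_inf_le

/-! ### Names and their hereditary size -/

namespace BName

variable {B : Type u}

/-- The index type of a name. -/
def Idx : BName B → Type u
  | mk o _ _ => o.ToType

/-- The names listed by a name. -/
def nm : (x : BName B) → x.Idx → BName B
  | mk _ A _ => A

/-- The Boolean values listed by a name. -/
def bv : (x : BName B) → x.Idx → B
  | mk _ _ b => b

theorem induction {p : BName B → Prop} (h : ∀ x, (∀ i, p (nm x i)) → p x) (x : BName B) : p x := by
  induction x with
  | mk o A b ih => exact h _ ih

/-- A listing of a type by the ordinal of its cardinality. -/
noncomputable def ordEquiv (ι : Type u) : (#ι).ord.ToType ≃ ι :=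
  (Cardinal.eq.1 ((Cardinal.mk_toType _).trans (Cardinal.card_ord _))).some

/-- The name `{(A i, b i) : i}`, for a family over an arbitrary type. -/
noncomputable def ofFamily {ι : Type u} (A : ι → BName B) (b : ι → B) : BName B :=
  mk (#ι).ord (A ∘ ordEquiv ι) (b ∘ ordEquiv ι)

theorem hereditarilyLE_ofFamily {κ : Cardinal.{u}} {ι : Type u} {A : ι → BName B} {b : ι → B}
    (h : #ι ≤ κ) (hA : ∀ i, HereditarilyLE κ (A i)) : HereditarilyLE κ (ofFamily A b) :=
  ⟨by simpa using h, fun _ => hA _⟩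

theorem HereditarilyLE.nm {κ : Cardinal.{u}} {x : BName B} (h : HereditarilyLE κ x) (i : x.Idx) :
    HereditarilyLE κ (x.nm i) := by
  cases x; exact h.2 i

theorem HereditarilyLE.mk_idx_le {κ : Cardinal.{u}} {x : BName B} (h : HereditarilyLE κ x) :
    #x.Idx ≤ κ := by
  cases x; exact (Cardinal.mk_toType _).trans_le h.1

/-- The family lists the transitive closure of the name: for each listed element, that element
itself (`none`) and the closure obtained for it by induction (`some`). The count is `κ * κ = κ`. -/
theorem HereditarilyLE.exists_closure {κ : Cardinal.{u}} (hκ : ℵ₀ ≤ κ) {x : BName B}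
    (h : HereditarilyLE κ x) : ∃ (ι : Type u) (A : ι → BName B), #ι ≤ κ ∧
      (∀ i j, (A i).nm j ∈ Set.range A) ∧ ∀ j, x.nm j ∈ Set.range A := by
  induction x using induction with
  | h x ih =>
    choose ι A hι hA hx using fun i => ih i (h.nm i)
    refine ⟨Σ i : x.Idx, Option (ι i), fun p => p.2.elim (x.nm p.1) (A p.1), ?_, ?_, ?_⟩
    · rw [Cardinal.mk_sigma]
      refine (Cardinal.sum_le_mk_mul_iSup _).trans
        ((mul_le_mul' h.mk_idx_le (ciSup_le' (a := κ) fun i => ?_)).trans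
          (Cardinal.mul_eq_self hκ).le)
      rw [Cardinal.mk_option]
      exact Cardinal.add_le_of_le hκ (hι i) (Cardinal.one_le_aleph0.trans hκ)
    · rintro ⟨i, _ | k⟩ j
      · obtain ⟨k, hk⟩ := hx i j
        exact ⟨⟨i, some k⟩, hk⟩
      · obtain ⟨l, hl⟩ := hA i k j
        exact ⟨⟨i, some l⟩, hl⟩
    · exact fun j => ⟨⟨j, none⟩, rfl⟩

/-! ### Boolean valued equality and membership -/

variable [CompleteBooleanAlgebra B] {Γ : B}

theorem memVal_eq (x y : BName B) : memVal x y = ⨆ i, bv y i ⊓ eqVal x (nm y i) := by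
  cases y; rfl

theorem eqVal_eq (x y : BName B) :
    eqVal x y = (⨅ i, bv x i ⇨ ⨆ j, bv y j ⊓ eqVal (nm x i) (nm y j)) ⊓
      (⨅ j, bv y j ⇨ ⨆ i, bv x i ⊓ eqVal (nm x i) (nm y j)) := by
  cases x; cases y; rw [eqVal]; rfl

theorem eqVal_comm (x y : BName B) : eqVal x y = eqVal y x := by
  induction x using induction generalizing y with
  | h x ih => rw [eqVal_eq, eqVal_eq y x, inf_comm]; simp only [ih]

theorem eqVal_eq_memVal (x y : BName B) :
    eqVal x y = (⨅ i, bv x i ⇨ memVal (nm x i) y) ⊓ (⨅ j, bv y j ⇨ memVal (nm y j) x) := by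
  simp only [memVal_eq]
  rw [eqVal_eq]; simp only [eqVal_comm (nm y _)]

theorem le_eqVal_iff {x y : BName B} : Γ ≤ eqVal x y ↔
    (∀ i, Γ ⊓ bv x i ≤ memVal (nm x i) y) ∧ (∀ j, Γ ⊓ bv y j ≤ memVal (nm y j) x) := by
  simp only [eqVal_eq_memVal, le_inf_iff, le_iInf_iff, le_himp_iff]

@[simp] theorem eqVal_refl (x : BName B) : eqVal x x = ⊤ := by
  induction x using induction with
  | h x ih =>
    have : ∀ i, ⊤ ⊓ bv x i ≤ memVal (nm x i) x := fun i => by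
      rw [memVal_eq, top_inf_eq]
      exact le_iSup_of_le i (by rw [ih, inf_top_eq])
    exact top_le_iff.1 (le_eqVal_iff.2 ⟨this, this⟩)

theorem bv_le_memVal (x : BName B) (i : x.Idx) : bv x i ≤ memVal (nm x i) x := by
  rw [memVal_eq]; exact le_iSup_of_le i (by rw [eqVal_refl, inf_top_eq])

theorem le_eqVal_symm {x y : BName B} (h : Γ ≤ eqVal x y) : Γ ≤ eqVal y x := eqVal_comm x y ▸ h

/-- Passing to an arbitrary `Δ ≤ Γ` absorbs the new assumptions into the condition; earlier
inequalities persist by transitivity. -/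
theorem le_memVal_elim {x y : BName B} {c : B} (h : Γ ≤ memVal x y)
    (H : ∀ i, ∀ Δ ≤ Γ, Δ ≤ bv y i → Δ ≤ eqVal x (nm y i) → Δ ≤ c) : Γ ≤ c := by
  rw [memVal_eq] at h
  exact le_of_le_iSup h fun i => H i _ inf_le_left (inf_le_right.trans inf_le_left)
    (inf_le_right.trans inf_le_right)

theorem le_memVal_intro {x y : BName B} (i : y.Idx) (h₁ : Γ ≤ bv y i)
    (h₂ : Γ ≤ eqVal x (nm y i)) : Γ ≤ memVal x y := by
  rw [memVal_eq]; exact le_iSup_of_le i (le_inf h₁ h₂)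

theorem le_nm_memVal {x y : BName B} (h : Γ ≤ eqVal x y) (i : x.Idx) (hi : Γ ≤ bv x i) :
    Γ ≤ memVal (nm x i) y :=
  (le_inf le_rfl hi).trans ((le_eqVal_iff.1 h).1 i)

/-- Elements of `x` are followed through `y` into `z`, and elements of `z` back through `y` into
`x`. Both times the induction hypothesis is used at the element of `x`, so induction on `x` alone
suffices once `y`, `z` and `Γ` are arbitrary. -/
theorem le_eqVal_trans {x y z : BName B} {Γ : B} (h : Γ ≤ eqVal x y) (h' : Γ ≤ eqVal y z) :
    Γ ≤ eqVal x z := by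
  induction x using induction generalizing y z Γ with
  | h x ih =>
    refine le_eqVal_iff.2 ⟨fun i => ?_, fun j => ?_⟩
    · refine le_memVal_elim (le_nm_memVal (inf_le_left.trans h) i inf_le_right)
        fun j Δ hΔ hj e => ?_
      refine le_memVal_elim (le_nm_memVal ((hΔ.trans inf_le_left).trans h') j hj)
        fun k Δ' hΔ' hk e' => ?_
      exact le_memVal_intro k hk (ih i (hΔ'.trans e) e')
    · refine le_memVal_elim (le_nm_memVal (inf_le_left.trans (le_eqVal_symm h')) j inf_le_right)
        fun k Δ hΔ hk e => ?_
      refine le_memVal_elim (le_nm_memVal ((hΔ.trans inf_le_left).trans (le_eqVal_symm h)) k hk)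
        fun i Δ' hΔ' hi e' => ?_
      exact le_memVal_intro i hi
        (le_eqVal_symm (ih i (le_eqVal_symm e') (le_eqVal_symm (hΔ'.trans e))))

theorem le_memVal_congr_left {x y z : BName B} (h : Γ ≤ eqVal x y) (h' : Γ ≤ memVal x z) :
    Γ ≤ memVal y z :=
  le_memVal_elim h' fun i _ hΔ hi e =>
    le_memVal_intro i hi (le_eqVal_trans (le_eqVal_symm (hΔ.trans h)) e)

theorem le_memVal_congr_right {x y z : BName B} (h : Γ ≤ eqVal x y) (h' : Γ ≤ memVal z x) :
    Γ ≤ memVal z y :=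
  le_memVal_elim h' fun i _ hΔ hi e =>
    le_memVal_congr_left (le_eqVal_symm e) (le_nm_memVal (hΔ.trans h) i hi)

theorem le_eqVal_of_forall {x y : BName B} (h : ∀ z, Γ ⊓ memVal z x ≤ memVal z y)
    (h' : ∀ z, Γ ⊓ memVal z y ≤ memVal z x) : Γ ≤ eqVal x y :=
  le_eqVal_iff.2 ⟨fun i => (inf_le_inf_left _ (bv_le_memVal x i)).trans (h _),
    fun i => (inf_le_inf_left _ (bv_le_memVal y i)).trans (h' _)⟩

theorem le_subsetVal_iff {x y : BName B} :
    Γ ≤ subsetVal x y ↔ ∀ i, Γ ⊓ bv x i ≤ memVal (nm x i) y := by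
  simp only [subsetVal, le_iInf_iff, le_himp_iff]
  refine ⟨fun h i => (inf_le_inf_left _ (bv_le_memVal x i)).trans (h _), fun h z => ?_⟩
  refine le_memVal_elim inf_le_right fun i Δ hΔ hi e => ?_
  exact le_memVal_congr_left (le_eqVal_symm e)
    ((le_inf (hΔ.trans inf_le_left) hi).trans (h i))

theorem le_memVal_of_subset {x y z : BName B} (h : Γ ≤ subsetVal x y) (hz : Γ ≤ memVal z x) :
    Γ ≤ memVal z y :=
  le_of_le_himp (h.trans (iInf_le _ z)) hz

/-- If `x` equals one of its listed elements `x_i`, then `x_i ∈ x = x_i`, against the induction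
hypothesis. This is what separates the canonical names of distinct ordinals. -/
theorem memVal_self (x : BName B) : memVal x x = ⊥ := by
  induction x using induction with
  | h x ih =>
    refine le_bot_iff.1 (le_memVal_elim le_rfl fun i Δ _ hi e => ?_)
    rw [← ih i]
    exact le_memVal_congr_right e (le_memVal_intro i hi (by simp))

/-! ### Names given by families -/

theorem memVal_ofFamily {ι : Type u} (A : ι → BName B) (b : ι → B) (x : BName B) :
    memVal x (ofFamily A b) = ⨆ i, b i ⊓ eqVal x (A i) :=
  (ordEquiv ι).iSup_comp
    (g := fun i => b i ⊓ eqVal x (A i))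

theorem le_memVal_ofFamily {ι : Type u} {A : ι → BName B} {b : ι → B} {x : BName B} (i : ι)
    (h₁ : Γ ≤ b i) (h₂ : Γ ≤ eqVal x (A i)) : Γ ≤ memVal x (ofFamily A b) := by
  rw [memVal_ofFamily]; exact le_iSup_of_le i (le_inf h₁ h₂)

theorem le_memVal_ofFamily_elim {ι : Type u} {A : ι → BName B} {b : ι → B} {x : BName B} {c : B}
    (h : Γ ≤ memVal x (ofFamily A b))
    (H : ∀ i, ∀ Δ ≤ Γ, Δ ≤ b i → Δ ≤ eqVal x (A i) → Δ ≤ c) : Γ ≤ c := by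
  rw [memVal_ofFamily] at h
  exact le_of_le_iSup h fun i => H i _ inf_le_left (inf_le_right.trans inf_le_left)
    (inf_le_right.trans inf_le_right)

/-! ### Pairs -/

/-- The name of the unordered pair. -/
noncomputable def upair (x y : BName B) : BName B :=
  ofFamily (fun i : ULift.{u} Bool => if i.down then x else y) (fun _ => ⊤)

@[simp] theorem memVal_upair (x y z : BName B) :
    memVal z (upair x y) = eqVal z x ⊔ eqVal z y := by
  rw [upair, memVal_ofFamily]
  rw [← Equiv.ulift.symm.iSup_comp, iSup_bool_eq]
  simp

/-- By extensionality the formula defining a pair can be traded for equality with a concrete name,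
so that quantifiers over pairs disappear. -/
theorem le_pairVal_iff {p x y : BName B} : Γ ≤ pairVal p x y ↔ Γ ≤ eqVal p (upair x y) := by
  simp only [pairVal, ← memVal_upair, le_iInf_iff, le_inf_iff, le_himp_iff]
  exact ⟨fun h => le_eqVal_of_forall (fun z => (h z).1) (fun z => (h z).2),
    fun h z => ⟨le_memVal_congr_right (inf_le_left.trans h) inf_le_right,
      le_memVal_congr_right (le_eqVal_symm (inf_le_left.trans h)) inf_le_right⟩⟩

/-- The name of the ordered pair. -/
noncomputable def opair (x y : BName B) : BName B := upair (upair x x) (upair x y)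

theorem le_eqVal_upair {x y x' y' : BName B} (h : Γ ≤ eqVal x x') (h' : Γ ≤ eqVal y y') :
    Γ ≤ eqVal (upair x y) (upair x' y') := by
  refine le_eqVal_of_forall (fun z => ?_) (fun z => ?_) <;> simp only [memVal_upair]
  · refine le_of_le_sup inf_le_right (le_sup_of_le_left ?_) (le_sup_of_le_right ?_)
    · exact le_eqVal_trans inf_le_right ((inf_le_left.trans inf_le_left).trans h)
    · exact le_eqVal_trans inf_le_right ((inf_le_left.trans inf_le_left).trans h')
  · refine le_of_le_sup inf_le_right (le_sup_of_le_left ?_) (le_sup_of_le_right ?_)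
    · exact le_eqVal_trans inf_le_right
        (le_eqVal_symm ((inf_le_left.trans inf_le_left).trans h))
    · exact le_eqVal_trans inf_le_right
        (le_eqVal_symm ((inf_le_left.trans inf_le_left).trans h'))

theorem le_eqVal_opair {x y x' y' : BName B} (h : Γ ≤ eqVal x x') (h' : Γ ≤ eqVal y y') :
    Γ ≤ eqVal (opair x y) (opair x' y') :=
  le_eqVal_upair (le_eqVal_upair h h) (le_eqVal_upair h h')

theorem orderedPairVal_eq (p x y : BName B) : orderedPairVal p x y = eqVal p (opair x y) := by
  apply le_antisymm
  · simp only [orderedPairVal, iSup_le_iff]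
    intro a b
    have h₁ := le_pairVal_iff.1 (inf_le_left.trans inf_le_left :
      pairVal a x x ⊓ pairVal b x y ⊓ pairVal p a b ≤ _)
    have h₂ := le_pairVal_iff.1 (inf_le_left.trans inf_le_right :
      pairVal a x x ⊓ pairVal b x y ⊓ pairVal p a b ≤ _)
    have h₃ := le_pairVal_iff.1 (inf_le_right :
      pairVal a x x ⊓ pairVal b x y ⊓ pairVal p a b ≤ _)
    exact le_eqVal_trans h₃ (le_eqVal_upair h₁ h₂)
  · refine le_iSup_of_le (upair x x) (le_iSup_of_le (upair x y) (le_inf (le_inf ?_ ?_) ?_))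
    · exact le_pairVal_iff.2 (le_top.trans (eqVal_refl _).ge)
    · exact le_pairVal_iff.2 (le_top.trans (eqVal_refl _).ge)
    · exact le_pairVal_iff.2 le_rfl

theorem le_left_of_upair_eq {x y z : BName B} (h : Γ ≤ eqVal (upair x y) z) : Γ ≤ memVal x z :=
  le_memVal_congr_right h (by simp)

theorem le_right_of_upair_eq {x y z : BName B} (h : Γ ≤ eqVal (upair x y) z) : Γ ≤ memVal y z :=
  le_memVal_congr_right h (by simp)

theorem le_eqVal_fst {x y x' y' : BName B} (h : Γ ≤ eqVal (opair x y) (opair x' y')) :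
    Γ ≤ eqVal x x' := by
  have h₁ := le_left_of_upair_eq h
  rw [opair, memVal_upair] at h₁
  refine le_of_le_sup h₁ ?_ ?_
  · have := le_left_of_upair_eq (inf_le_right : Γ ⊓ eqVal (upair x x) (upair x' x') ≤ _)
    simpa using this
  · have := le_left_of_upair_eq
      (le_eqVal_symm (inf_le_right : Γ ⊓ eqVal (upair x x) (upair x' y') ≤ _))
    exact le_eqVal_symm (by simpa using this)

theorem le_snd_cases {x y x' y' : BName B} (h : Γ ≤ eqVal (opair x y) (opair x' y')) :
    Γ ≤ eqVal y x' ⊔ eqVal y y' := by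
  have h₁ := le_right_of_upair_eq h
  rw [opair, memVal_upair] at h₁
  refine le_of_le_sup h₁ ?_ ?_
  · have := le_right_of_upair_eq (inf_le_right : Γ ⊓ eqVal (upair x y) (upair x' x') ≤ _)
    exact le_sup_of_le_left (by simpa using this)
  · have := le_right_of_upair_eq (inf_le_right : Γ ⊓ eqVal (upair x y) (upair x' y') ≤ _)
    simpa using this

theorem le_eqVal_snd {x y x' y' : BName B} (h : Γ ≤ eqVal (opair x y) (opair x' y')) :
    Γ ≤ eqVal y y' := by
  refine le_of_le_sup (le_snd_cases h) ?_ inf_le_right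
  refine le_of_le_sup (inf_le_left.trans (le_snd_cases (le_eqVal_symm h))) ?_
    (le_eqVal_symm inf_le_right)
  -- In the remaining case `y = x'` and `y' = x`; since first coordinates agree, `y = x' = x = y'`.
  have e₁ : Γ ⊓ eqVal y x' ⊓ eqVal y' x ≤ eqVal y x' := inf_le_left.trans inf_le_right
  have e₂ : Γ ⊓ eqVal y x' ⊓ eqVal y' x ≤ eqVal x x' :=
    (inf_le_left.trans inf_le_left).trans (le_eqVal_fst h)
  exact le_eqVal_trans e₁ (le_eqVal_trans (le_eqVal_symm e₂) (le_eqVal_symm inf_le_right))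

theorem pairMemVal_eq (f x y : BName B) : pairMemVal f x y = memVal (opair x y) f := by
  simp only [pairMemVal, orderedPairVal_eq]
  apply le_antisymm
  · exact iSup_le fun p => le_memVal_congr_left inf_le_left inf_le_right
  · exact le_iSup_of_le (opair x y) (by simp)

/-! ### Ordinals -/

theorem memVal_check (α : Ordinal.{u}) (x : BName B) :
    memVal x (check B α) = ⨆ i : α.ToType, eqVal x (check B i.toOrd.1) := by
  rw [check, memVal]; simp

theorem memVal_check_of_lt {α β : Ordinal.{u}} (h : α < β) :
    memVal (check B α) (check B β) = ⊤ := by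
  rw [memVal_check, eq_top_iff]
  exact le_iSup_of_le (Ordinal.ToType.mk ⟨α, h⟩) (by simp)

theorem eqVal_check_of_ne {α β : Ordinal.{u}} (h : α ≠ β) :
    eqVal (check B α) (check B β) = ⊥ := by
  wlog hlt : α < β generalizing α β
  · rw [eqVal_comm]; exact this h.symm (lt_of_le_of_ne (not_lt.1 hlt) h.symm)
  · rw [← le_bot_iff, ← memVal_self (check B β)]
    exact le_memVal_congr_left le_rfl (by rw [memVal_check_of_lt hlt]; exact le_top)

/-! ### Hereditarily small names -/

/-- The surjection is named by the pairs `(ě(i), A i)` for an injection `e` of the index type into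
`κ`. It is single valued since canonical names of distinct ordinals are equal with value `⊥`. -/
theorem cardLEVal_ofFamily {κ : Cardinal.{u}} {ι : Type u} (A : ι → BName B) (hι : #ι ≤ κ) :
    cardLEVal (ofFamily A fun _ => ⊤) (check B κ.ord) = ⊤ := by
  obtain ⟨e⟩ : #ι ≤ #κ.ord.ToType := by simpa using hι
  have he : ∀ {i j}, (e i).toOrd.1 = (e j).toOrd.1 → i = j := fun h =>
    e.injective (Ordinal.ToType.mk.symm.injective (Subtype.ext h))
  rw [eq_top_iff]
  refine le_iSup_of_le
    (ofFamily (fun i => opair (check B (e i).toOrd.1) (A i)) fun _ => ⊤) (le_inf ?_ ?_)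
  · simp only [le_iInf_iff, le_himp_iff, top_inf_eq, pairMemVal_eq]
    intro x y z
    refine le_memVal_ofFamily_elim inf_le_left fun i Δ hΔ _ h => ?_
    refine le_memVal_ofFamily_elim (hΔ.trans inf_le_right) fun j Δ' hΔ' _ h' => ?_
    replace h := hΔ'.trans h
    by_cases hij : i = j
    · subst hij
      exact le_eqVal_trans (le_eqVal_snd h) (le_eqVal_symm (le_eqVal_snd h'))
    · have := le_eqVal_trans (le_eqVal_symm (le_eqVal_fst h)) (le_eqVal_fst h')
      rw [eqVal_check_of_ne fun h => hij (he h)] at this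
      exact this.trans bot_le
  · simp only [le_iInf_iff, le_himp_iff, top_inf_eq, pairMemVal_eq]
    intro y
    refine le_memVal_ofFamily_elim le_rfl fun i Δ hΔ _ h => ?_
    refine le_iSup_of_le (check B (e i).toOrd.1) (le_inf ?_ ?_)
    · rw [memVal_check_of_lt (e i).toOrd.2]; exact le_top
    · exact le_memVal_ofFamily i le_top (le_eqVal_opair (by simp) h)

/-- The transitive closure with all Boolean values raised to `⊤` names a transitive set that
includes `x`. -/
theorem HereditarilyLE.memHVal_eq_top {κ : Cardinal.{u}} (hκ : ℵ₀ ≤ κ) {x : BName B}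
    (h : HereditarilyLE κ x) : memHVal (check B κ.ord) x = ⊤ := by
  obtain ⟨ι, A, hι, hA, hx⟩ := h.exists_closure hκ
  have key : ∀ {Γ : B} {y : BName B}, (∀ j, y.nm j ∈ Set.range A) →
      Γ ≤ subsetVal y (ofFamily A fun _ => ⊤) := fun hy => le_subsetVal_iff.2 fun j => by
    obtain ⟨k, hk⟩ := hy j
    exact le_memVal_ofFamily k le_top (by rw [hk]; simp)
  rw [eq_top_iff]
  refine le_iSup_of_le (ofFamily A fun _ => ⊤) (le_inf (le_inf ?_ (key hx)) ?_)
  · simp only [transitiveVal, le_iInf_iff, le_himp_iff, top_inf_eq]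
    intro y
    refine le_memVal_ofFamily_elim le_rfl fun i Δ _ _ h => ?_
    simp only [subsetVal, le_iInf_iff, le_himp_iff]
    exact fun z => le_memVal_of_subset (key (hA i))
      (le_memVal_congr_right (inf_le_left.trans h) inf_le_right)
  · rw [cardLEVal_ofFamily A hι]

end BName

/-! ### Small names for the elements of `H_{κ̌⁺}` -/

namespace BName

variable {B : Type u} [CompleteBooleanAlgebra B]

/-- If `x` is contained in a transitive set onto which `κ` is mapped by `f`, then `x` has a name
that is hereditarily of size at most `κ`. -/
theorem exists_hereditarilyLE_eqVal {κ : Cardinal.{u}} (hκ : ℵ₀ ≤ κ) (hB : #B ≤ κ) {t f : BName B}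
    {Γ : B} (ht : Γ ≤ transitiveVal t)
    (hf : Γ ≤ ⨅ (x : BName B) (y : BName B) (z : BName B),
      pairMemVal f x y ⊓ pairMemVal f x z ⇨ eqVal y z)
    (hs : Γ ≤ ⨅ y : BName B, memVal y t ⇨
      ⨆ x : BName B, memVal x (check B κ.ord) ⊓ pairMemVal f x y)
    {x : BName B} (hx : Γ ≤ subsetVal x t) :
    ∃ c : BName B, HereditarilyLE κ c ∧ Γ ≤ eqVal x c := by
  induction x using induction generalizing Γ with
  | h x ih =>
    have hmem := le_subsetVal_iff.1 hx
    have hsub : ∀ i, Γ ⊓ bv x i ≤ subsetVal (nm x i) t := fun i =>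
      le_of_le_himp ((inf_le_left.trans ht).trans (iInf_le _ _)) (hmem i)
    choose c hc hxc using fun i => ih i (inf_le_left.trans ht) (inf_le_left.trans hf)
      (inf_le_left.trans hs) (hsub i)
    -- The value, below `Γ`, of "`x_i` is listed in `x` and `f` sends `α` to `x_i`".
    let E (α : κ.ord.ToType) (i : x.Idx) : B :=
      Γ ⊓ bv x i ⊓ pairMemVal f (check B α.toOrd.1) (nm x i)
    -- The name `x` may list far more than `κ` elements, but at most `κ * #B ≤ κ` pairs `(α, E α i)`
    -- occur. One index `i` per pair is enough: indices with the same pair name, below that common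
    -- value, the same set `f(α)`.
    let ι : Type u := {p : κ.ord.ToType × B // ∃ i, p.2 = E p.1 i}
    choose idx hidx using fun p : ι => p.2
    refine ⟨ofFamily (fun p => c (idx p)) (fun p => p.1.2),
      hereditarilyLE_ofFamily ?_ fun _ => hc _, le_eqVal_of_forall (fun z => ?_) fun z => ?_⟩
    · refine (Cardinal.mk_subtype_le _).trans ?_
      rw [Cardinal.mk_prod, Cardinal.lift_id, Cardinal.lift_id, Cardinal.mk_toType,
        Cardinal.card_ord]
      exact (mul_le_mul_right hB κ).trans (Cardinal.mul_eq_self hκ).le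
    · refine le_memVal_elim inf_le_right fun i Δ hΔ hi hz => ?_
      have hΔΓ : Δ ≤ Γ := hΔ.trans inf_le_left
      have h₁ := le_of_le_himp ((hΔΓ.trans hs).trans (iInf_le _ (nm x i)))
        ((le_inf hΔΓ hi).trans (hmem i))
      refine le_of_le_iSup h₁ fun y => ?_
      have h₂ := (inf_le_right :
        Δ ⊓ (memVal y (check B κ.ord) ⊓ pairMemVal f y (nm x i)) ≤ _).trans inf_le_left
      refine le_of_le_iSup (h₂.trans_eq (memVal_check _ _)) fun α => ?_
      set Δ' := Δ ⊓ (memVal y (check B κ.ord) ⊓ pairMemVal f y (nm x i)) ⊓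
        eqVal y (check B α.toOrd.1)
      have hΔ' : Δ' ≤ Δ := inf_le_left.trans inf_le_left
      have h₃ : Δ' ≤ pairMemVal f (check B α.toOrd.1) (nm x i) := by
        have h₄ : Δ' ≤ pairMemVal f y (nm x i) :=
          inf_le_left.trans (inf_le_right.trans inf_le_right)
        rw [pairMemVal_eq] at h₄ ⊢
        exact le_memVal_congr_left (le_eqVal_opair inf_le_right (by simp)) h₄
      have hE : Δ' ≤ E α i := le_inf (le_inf (hΔ'.trans hΔΓ) (hΔ'.trans hi)) h₃
      let p : ι := ⟨(α, E α i), i, rfl⟩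
      have hE' : Δ' ≤ E α (idx p) := hE.trans_eq (hidx p)
      refine le_memVal_ofFamily p hE ?_
      -- Below `Δ'` both `x_i` and the chosen representative are images of `α`, so they are equal.
      have h₅ := le_of_le_himp (((hΔ'.trans hΔΓ).trans hf).trans ((iInf_le _ _).trans
        ((iInf_le _ _).trans (iInf_le _ _)))) (le_inf h₃ (hE'.trans inf_le_right))
      exact le_eqVal_trans (hΔ'.trans hz) (le_eqVal_trans h₅
        ((hE'.trans inf_le_left).trans (hxc _)))
    · refine le_memVal_ofFamily_elim inf_le_right fun p Δ _ hp hz => ?_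
      rw [hidx p] at hp
      exact le_memVal_intro (idx p) (hp.trans (inf_le_left.trans inf_le_right))
        (le_eqVal_trans hz (le_eqVal_symm ((hp.trans inf_le_left).trans (hxc _))))

/-- The value of `x ∈ H_{κ̌⁺}` is a supremum over transitive sets `t` and maps `f`; shrinking `Γ` to
a nonzero `Δ` fixes one `t` and one `f`. -/
theorem exists_name_of_le_memHVal {κ : Cardinal.{u}} (hκ : ℵ₀ ≤ κ) (hB : #B ≤ κ) {Γ : B}
    (hΓ : ⊥ < Γ) {x : BName B} (hx : Γ ≤ memHVal (check B κ.ord) x) :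
    ∃ (c : Names B κ) (Δ : B), Δ ≤ Γ ∧ ⊥ < Δ ∧ Δ ≤ eqVal x c := by
  by_contra! H
  refine hΓ.not_ge (le_of_le_iSup hx fun t => ?_)
  refine le_of_le_iSup (inf_le_right.trans inf_le_right) fun f => ?_
  by_contra hne
  set Δ := Γ ⊓ (transitiveVal t ⊓ subsetVal x t ⊓ cardLEVal t (check B κ.ord)) ⊓ _
  have hΔ : Δ ≤ Γ ⊓ (transitiveVal t ⊓ subsetVal x t ⊓ cardLEVal t (check B κ.ord)) :=
    inf_le_left
  have hts := (hΔ.trans inf_le_right).trans inf_le_left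
  obtain ⟨c, hc, hxc⟩ := exists_hereditarilyLE_eqVal hκ hB (hts.trans inf_le_left)
    (inf_le_right.trans inf_le_left : Δ ≤ _) (inf_le_right.trans inf_le_right : Δ ≤ _)
    (hts.trans inf_le_right)
  exact H ⟨c, hc⟩ Δ (hΔ.trans inf_le_left) (bot_lt_iff_ne_bot.2 fun h => hne h.le) hxc

theorem exists_names_of_le_memHVal {κ : Cardinal.{u}} (hκ : ℵ₀ ≤ κ) (hB : #B ≤ κ) {m : ℕ} {Γ : B}
    (hΓ : ⊥ < Γ) {x : Fin m → BName B} (hx : ∀ i, Γ ≤ memHVal (check B κ.ord) (x i)) :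
    ∃ (c : Fin m → Names B κ) (Δ : B), Δ ≤ Γ ∧ ⊥ < Δ ∧ ∀ i, Δ ≤ eqVal (x i) (c i) := by
  induction m generalizing Γ with
  | zero => exact ⟨Fin.elim0, Γ, le_rfl, hΓ, fun i => i.elim0⟩
  | succ m ih =>
    obtain ⟨c₀, Δ, hΔ, hpos, h₀⟩ := exists_name_of_le_memHVal hκ hB hΓ (hx 0)
    obtain ⟨c, Δ', hΔ', hpos', h⟩ := ih hpos fun i => hΔ.trans (hx i.succ)
    exact ⟨Fin.cons c₀ c, Δ', hΔ'.trans hΔ, hpos',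
      Fin.cases (hΔ'.trans h₀) fun i => by simpa using h i⟩

end BName

/-! ### Boolean values of formulas -/

namespace Tm

variable {C M : Type (u + 1)} (ι : C → M)

theorem val_subst {n k : ℕ} (s : Tm C n) (σ : Fin n → Tm C k) (v : Fin k → M) :
    (s.subst σ).val ι v = s.val ι fun i => (σ i).val ι v := by
  cases s <;> rfl

theorem val_liftSubst {n k m : ℕ} (σ : Fin n → Tm C k)
    (x : Fin m → M) (v : Fin k → M) :
    (fun i => (Tm.liftSubst m σ i).val ι (Fin.append x v)) =
      Fin.append x fun i => (σ i).val ι v := by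
  funext i
  refine Fin.addCases (fun i => ?_) (fun i => ?_) i
  · simp [Tm.liftSubst, Tm.val]
  · simp only [Tm.liftSubst, Fin.addCases_right, Fin.append_right, Tm.shift, Tm.val_subst]
    simp [Tm.val]

end Tm

namespace Fml

theorem inL_subst {C : Type (u + 1)} {lam : Cardinal.{u}} {n k : ℕ} (φ : Fml C n)
    (σ : Fin n → Tm C k) : (φ.subst σ).InL lam ↔ φ.InL lam := by
  induction φ generalizing k with
  | mem | eq => rfl
  | neg φ ih | all m φ ih | ex m φ ih => exact ih _
  | conj o Φ ih | disj o Φ ih => exact and_congr_right' (forall_congr' fun i => ih i _)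

theorem inL_negInside {C : Type (u + 1)} {lam : Cardinal.{u}} {n : ℕ} (φ : Fml C n) :
    φ.negInside.InL lam ↔ φ.InL lam := by
  cases φ <;> rfl

variable {B : Type u} [CompleteBooleanAlgebra B] {C : Type (u + 1)} (ι : C → BName B)
    (H : BName B → B)

theorem relVal_subst {n k : ℕ} (φ : Fml C n) (σ : Fin n → Tm C k) (v : Fin k → BName B) :
    (φ.subst σ).relVal ι H v = φ.relVal ι H fun i => (σ i).val ι v := by
  induction φ generalizing k with
  | mem | eq => simp only [subst, relVal, Tm.val_subst]
  | neg φ ih | conj o Φ ih | disj o Φ ih => simp only [subst, relVal, ih]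
  | all m φ ih | ex m φ ih => simp only [subst, relVal, ih, Tm.val_liftSubst]

theorem relVal_inst {n : ℕ} (φ : Fml C n) (c : Fin n → C) :
    (φ.inst c).relVal ι H Fin.elim0 = φ.relVal ι H fun i => ι (c i) :=
  relVal_subst ι H φ _ _

theorem relVal_negInside {n : ℕ} (φ : Fml C n) (v : Fin n → BName B) :
    φ.negInside.relVal ι H v = (φ.relVal ι H v)ᶜ := by
  cases φ with
  | mem | eq => rfl
  | neg φ => exact (compl_compl _).symm
  | conj o Φ => exact compl_iInf.symm
  | disj o Φ => exact compl_iSup.symm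
  | all m φ =>
    simp only [negInside, relVal, compl_iInf (ι := _ → _), compl_himp, sdiff_eq]
  | ex m φ => simp only [negInside, relVal, compl_iSup, himp_eq, compl_inf, sup_comm]

theorem _root_.ForcingConsistency.Tm.le_eqVal_val {n : ℕ} (s : Tm C n) {v w : Fin n → BName B}
    {Γ : B} (h : ∀ i, Γ ≤ BName.eqVal (v i) (w i)) :
    Γ ≤ BName.eqVal (s.val ι v) (s.val ι w) := by
  cases s with
  | const c => simp [Tm.val]
  | var i => exact h i

theorem le_eqVal_append {n m : ℕ} (x : Fin m → BName B) {v w : Fin n → BName B}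
    {Γ : B} (h : ∀ i, Γ ≤ BName.eqVal (v i) (w i)) (i : Fin (m + n)) :
    Γ ≤ BName.eqVal (Fin.append x v i) (Fin.append x w i) := by
  refine Fin.addCases (fun i => ?_) (fun i => ?_) i
  · simp
  · simpa using h i

/-- Nothing is required of `H`: the bound strings are the same on both sides, and only the free
assignment changes. Negation uses the induction hypothesis from `w` back to `v`. -/
theorem relVal_congr {n : ℕ} (φ : Fml C n) {v w : Fin n → BName B} {Γ : B}
    (h : ∀ i, Γ ≤ BName.eqVal (v i) (w i)) (hφ : Γ ≤ φ.relVal ι H v) : Γ ≤ φ.relVal ι H w := by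
  induction φ generalizing Γ with
  | mem s t =>
    exact BName.le_memVal_congr_left (s.le_eqVal_val ι h)
      (BName.le_memVal_congr_right (t.le_eqVal_val ι h) hφ)
  | eq s t =>
    exact BName.le_eqVal_trans (BName.le_eqVal_symm (s.le_eqVal_val ι h))
      (BName.le_eqVal_trans hφ (t.le_eqVal_val ι h))
  | neg φ ih =>
    simp only [relVal] at hφ ⊢
    rw [le_compl_iff_disjoint_right, disjoint_iff_inf_le]
    have h₁ := ih (fun i => BName.le_eqVal_symm (inf_le_left.trans (h i)))
      (inf_le_right : Γ ⊓ φ.relVal ι H w ≤ _)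
    exact (le_inf h₁ (inf_le_left.trans hφ)).trans (by simp)
  | conj o Φ ih =>
    exact le_iInf fun i => ih i h (hφ.trans (iInf_le _ i))
  | disj o Φ ih =>
    exact le_of_le_iSup hφ fun i => le_iSup_of_le i
      (ih i (fun j => inf_le_left.trans (h j)) inf_le_right)
  | all m φ ih =>
    exact le_iInf fun x => le_himp_iff.2 (ih
      (fun i => inf_le_left.trans (le_eqVal_append x h i))
      (le_of_le_himp (inf_le_left.trans (hφ.trans (iInf_le _ x))) inf_le_right))
  | ex m φ ih =>
    exact le_of_le_iSup hφ fun x => le_iSup_of_le x (le_inf (inf_le_right.trans inf_le_left) (ih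
      (fun i => inf_le_left.trans (le_eqVal_append x h i))
      (inf_le_right.trans inf_le_right)))

end Fml

/-! ### Smallness -/

/-- The ordinals of cardinality at most `κ` form a set. -/
theorem exists_ordinals_card_le (κ : Cardinal.{u}) :
    ∃ (I : Type u) (ω : I → Ordinal.{u}), ∀ o : Ordinal.{u}, o.card ≤ κ → o ∈ Set.range ω := by
  refine ⟨(Order.succ κ).ord.ToType, fun i => i.toOrd.1, fun o ho => ?_⟩
  exact ⟨Ordinal.ToType.mk ⟨o, Cardinal.lt_ord.2 (Order.lt_succ_of_le ho)⟩, by simp⟩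

/-- The name coded by a well-founded tree. -/
def BName.ofTree {B I : Type u} (ω : I → Ordinal.{u}) :
    WType (α := Σ i : I, ((ω i).ToType → B)) (fun p => (ω p.1).ToType) → BName B
  | ⟨a, f⟩ => BName.mk (ω a.1) (fun i => ofTree ω (f i)) a.2

/-- Such names branch only along ordinals of cardinality at most `κ`, which form a set, so
well-founded trees in the lower universe code them all. -/
theorem small_names (B : Type u) (κ : Cardinal.{u}) : Small.{u} (Names B κ) := by
  obtain ⟨I, ω, hω⟩ := exists_ordinals_card_le κ
  have : ∀ x : BName B, x.HereditarilyLE κ → x ∈ Set.range (BName.ofTree (B := B) ω) := by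
    intro x
    induction x with
    | mk o A b ih =>
      rintro ⟨ho, hA⟩
      obtain ⟨i, rfl⟩ := hω o ho
      choose f hf using fun j => ih j (hA j)
      exact ⟨⟨⟨i, b⟩, f⟩, by simp only [BName.ofTree, hf]⟩
  exact small_subset (t := {x : BName B | x.HereditarilyLE κ})
    (s := Set.range (BName.ofTree (B := B) ω)) this

theorem infinite_names (B : Type u) [Inhabited B] {κ : Cardinal.{u}} (hκ : ℵ₀ ≤ κ) :
    Infinite (Names B κ) := by
  let e : BName B := BName.mk 0 (fun i => (Ordinal.isEmpty_toType_zero.false i).elim)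
    fun _ => default
  have he : e.HereditarilyLE κ :=
    ⟨by simp, fun i => (Ordinal.isEmpty_toType_zero.false i).elim⟩
  -- The names listing `e` exactly `n` times differ as names because their lengths differ, whatever
  -- the Boolean values of their equalities.
  refine Infinite.of_injective (fun n : ℕ =>
    (⟨BName.mk n (fun _ => e) fun _ => default, ?_, fun _ => he⟩ : Names B κ)) fun n k h => ?_
  · simpa using (Cardinal.natCast_lt_aleph0 (n := n)).le.trans hκ
  · have := Subtype.ext_iff.1 h
    simp only [BName.mk.injEq] at this
    exact_mod_cast this.1

/-- Codes of formulas with constants in a set and conjunctions of sizes in a set. -/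
inductive FmlCode (C : Type u) {I : Type u} (ω : I → Ordinal.{u}) : ℕ → Type u
  | mem {n : ℕ} (s t : C ⊕ Fin n) : FmlCode C ω n
  | eq {n : ℕ} (s t : C ⊕ Fin n) : FmlCode C ω n
  | neg {n : ℕ} (φ : FmlCode C ω n) : FmlCode C ω n
  | conj {n : ℕ} (i : I) (Φ : (ω i).ToType → FmlCode C ω n) : FmlCode C ω n
  | disj {n : ℕ} (i : I) (Φ : (ω i).ToType → FmlCode C ω n) : FmlCode C ω n
  | all {n : ℕ} (m : ℕ) (φ : FmlCode C ω (m + n)) : FmlCode C ω n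
  | ex {n : ℕ} (m : ℕ) (φ : FmlCode C ω (m + n)) : FmlCode C ω n

/-- The term with a given code. -/
def Tm.ofCode {C : Type u} {D : Type (u + 1)} (e : C → D) {n : ℕ} : C ⊕ Fin n → Tm D n :=
  Sum.elim (fun c => Tm.const (e c)) Tm.var

theorem Tm.ofCode_surjective {C : Type u} {D : Type (u + 1)} {e : C → D}
    (he : Function.Surjective e) {n : ℕ} : Function.Surjective (Tm.ofCode e (n := n)) := by
  rintro (c | i)
  · obtain ⟨c, rfl⟩ := he c
    exact ⟨Sum.inl c, rfl⟩
  · exact ⟨Sum.inr i, rfl⟩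

/-- The formula with a given code. -/
def FmlCode.decode {C : Type u} {D : Type (u + 1)} (e : C → D) {I : Type u}
    {ω : I → Ordinal.{u}} : {n : ℕ} → FmlCode C ω n → Fml D n
  | _, mem s t => Fml.mem (Tm.ofCode e s) (Tm.ofCode e t)
  | _, eq s t => Fml.eq (Tm.ofCode e s) (Tm.ofCode e t)
  | _, neg φ => Fml.neg (φ.decode e)
  | _, conj i Φ => Fml.conj (ω i) fun j => (Φ j).decode e
  | _, disj i Φ => Fml.disj (ω i) fun j => (Φ j).decode e
  | _, all m φ => Fml.all m (φ.decode e)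
  | _, ex m φ => Fml.ex m (φ.decode e)

theorem small_inL (D : Type (u + 1)) [Small.{u} D] (lam : Cardinal.{u}) (n : ℕ) :
    Small.{u} {φ : Fml D n | φ.InL lam} := by
  obtain ⟨I, ω, hω⟩ := exists_ordinals_card_le lam
  let e : Shrink.{u} D → D := (equivShrink D).symm
  have he : Function.Surjective e := (equivShrink D).symm.surjective
  have : ∀ {n : ℕ} (φ : Fml D n), φ.InL lam →
      φ ∈ Set.range (FmlCode.decode e (ω := ω) (n := n)) := by
    intro n φ
    induction φ with
    | mem s t =>
      obtain ⟨s, rfl⟩ := Tm.ofCode_surjective he s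
      obtain ⟨t, rfl⟩ := Tm.ofCode_surjective he t
      exact fun _ => ⟨.mem s t, rfl⟩
    | eq s t =>
      obtain ⟨s, rfl⟩ := Tm.ofCode_surjective he s
      obtain ⟨t, rfl⟩ := Tm.ofCode_surjective he t
      exact fun _ => ⟨.eq s t, rfl⟩
    | neg φ ih =>
      intro h
      obtain ⟨ψ, rfl⟩ := ih h
      exact ⟨.neg ψ, rfl⟩
    | conj o Φ ih =>
      rintro ⟨ho, h⟩
      obtain ⟨i, rfl⟩ := hω o ho.le
      choose Ψ hΨ using fun j => ih j (h j)
      exact ⟨.conj i Ψ, by simp only [FmlCode.decode, hΨ]⟩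
    | disj o Φ ih =>
      rintro ⟨ho, h⟩
      obtain ⟨i, rfl⟩ := hω o ho.le
      choose Ψ hΨ using fun j => ih j (h j)
      exact ⟨.disj i Ψ, by simp only [FmlCode.decode, hΨ]⟩
    | all m φ ih =>
      intro h
      obtain ⟨ψ, rfl⟩ := ih h
      exact ⟨.all m ψ, rfl⟩
    | ex m φ ih =>
      intro h
      obtain ⟨ψ, rfl⟩ := ih h
      exact ⟨.ex m ψ, rfl⟩
  exact small_subset (t := {φ : Fml D n | φ.InL lam})
    (s := Set.range (FmlCode.decode e (ω := ω) (n := n))) fun φ => this φ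

/-- The subsets of a small set form a small collection. -/
theorem small_of_subset_small {α : Type*} {T : Set α} [Small.{u} T] (S : Set (Set α))
    (h : ∀ s ∈ S, s ⊆ T) : Small.{u} S := by
  refine small_of_injective (β := Set T) (f := fun s => {x | x.1 ∈ s.1}) fun s t hst => ?_
  refine Subtype.ext (Set.ext fun x => ⟨fun hx => ?_, fun hx => ?_⟩)
  · exact (Set.ext_iff.1 hst ⟨x, h _ s.2 hx⟩).1 hx
  · exact (Set.ext_iff.1 hst ⟨x, h _ t.2 hx⟩).2 hx

/-! ### The family `S_B` -/

section

variable (B : Type u) [CompleteBooleanAlgebra B] (κ lam : Cardinal.{u})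

theorem conjVal_union (s t : Set (Sentence (Names B κ))) :
    conjVal B κ (s ∪ t) = conjVal B κ s ⊓ conjVal B κ t :=
  iInf_union

theorem conjVal_singleton (φ : Sentence (Names B κ)) : conjVal B κ {φ} = sentVal B κ φ :=
  iInf_singleton

variable {B κ lam}

theorem conjVal_le {s : Set (Sentence (Names B κ))} {φ : Sentence (Names B κ)} (h : φ ∈ s) :
    conjVal B κ s ≤ sentVal B κ φ :=
  iInf₂_le φ h

theorem union_mem_consistencyFamily {s : Set (Sentence (Names B κ))} {φ : Sentence (Names B κ)}
    (hs : s ∈ consistencyFamily B κ lam) (hφ : φ.InL lam) {Γ : B} (hΓ : ⊥ < Γ)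
    (h₁ : Γ ≤ conjVal B κ s) (h₂ : Γ ≤ sentVal B κ φ) :
    s ∪ {φ} ∈ consistencyFamily B κ lam := by
  refine ⟨hs.1.union (Set.finite_singleton φ), ?_, ?_⟩
  · rintro ψ (hψ | rfl)
    exacts [hs.2.1 ψ hψ, hφ]
  · rw [conjVal_union, conjVal_singleton]
    exact hΓ.trans_le (le_inf h₁ h₂)

theorem union_mem_consistencyFamily_of_le {s : Set (Sentence (Names B κ))}
    {φ : Sentence (Names B κ)} (hs : s ∈ consistencyFamily B κ lam) (hφ : φ.InL lam)
    (h : conjVal B κ s ≤ sentVal B κ φ) : s ∪ {φ} ∈ consistencyFamily B κ lam :=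
  union_mem_consistencyFamily hs hφ hs.2.2 le_rfl h

theorem sentVal_inst {m : ℕ} (φ : Fml (Names B κ) m) (c : Fin m → Names B κ) :
    sentVal B κ (φ.inst c) =
      φ.relVal Subtype.val (BName.memHVal (BName.check B κ.ord)) fun i => (c i).1 :=
  Fml.relVal_inst _ _ φ c

/-- Takes the place of the maximum principle in Ind.4 and Ind.5: a witness is needed only below some
nonzero condition. -/
theorem exists_pos_inf_of_le_iSup {ι : Sort*} {f : ι → B} {Γ : B} (hΓ : ⊥ < Γ)
    (h : Γ ≤ ⨆ i, f i) : ∃ i, ⊥ < Γ ⊓ f i := by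
  by_contra! H
  exact hΓ.not_ge (le_of_le_iSup h fun i => (not_bot_lt_iff.1 (H i)).le)

theorem isConsistencyProperty_consistencyFamily (hκ : ℵ₀ ≤ κ) (hB : #B ≤ κ) :
    IsConsistencyProperty (consistencyFamily B κ lam) where
  small_constants := small_names B κ
  infinite_constants := have : Inhabited B := ⟨⊤⟩; infinite_names B hκ
  small := by
    have := small_names B κ
    have := small_inL (Names B κ) lam 0
    exact small_of_subset_small (T := {φ : Fml (Names B κ) 0 | φ.InL lam}) _ fun s hs => hs.2.1
  small_mem s hs := by
    have := hs.1.to_subtype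
    exact Countable.toSmall s
  con s hs φ := by
    by_contra! h
    refine hs.2.2.not_ge ((le_inf (conjVal_le h.1) (conjVal_le h.2)).trans ?_)
    exact (inf_compl_self _).le
  ind1 s hs φ h := by
    refine union_mem_consistencyFamily_of_le hs ((Fml.inL_negInside φ).2 (hs.2.1 (Fml.neg φ) h)) ?_
    exact (conjVal_le h).trans_eq (Fml.relVal_negInside _ _ φ _).symm
  ind2 s hs o Φ h i :=
    union_mem_consistencyFamily_of_le hs ((hs.2.1 _ h).2 i) ((conjVal_le h).trans (iInf_le _ i))
  ind3 s hs m φ h c := by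
    refine union_mem_consistencyFamily_of_le hs ((Fml.inL_subst _ _).2 (hs.2.1 _ h)) ?_
    rw [sentVal_inst]
    have := (conjVal_le h).trans (iInf_le _ fun i => (c i).1)
    rw [Fin.append_elim0] at this
    -- The restriction to `H_{κ̌⁺}` is vacuous for constants.
    exact le_of_le_himp this (le_iInf fun i => ((c i).2.memHVal_eq_top hκ).symm ▸ le_top)
  ind4 s hs o Φ h := by
    obtain ⟨i, hi⟩ := exists_pos_inf_of_le_iSup hs.2.2 (conjVal_le h)
    exact ⟨i, union_mem_consistencyFamily hs ((hs.2.1 _ h).2 i) hi inf_le_left inf_le_right⟩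
  ind5 s hs m φ h := by
    obtain ⟨x, hx⟩ := exists_pos_inf_of_le_iSup hs.2.2 (conjVal_le h)
    rw [Fin.append_elim0] at hx
    -- The witness `x` is an arbitrary string of names; on a smaller nonzero `Δ` it is replaced by
    -- constants.
    obtain ⟨c, Δ, hΔ, hpos, hc⟩ := BName.exists_names_of_le_memHVal hκ hB hx (x := x)
      fun i => inf_le_right.trans (inf_le_left.trans (iInf_le _ i))
    refine ⟨c, union_mem_consistencyFamily hs ((Fml.inL_subst _ _).2 (hs.2.1 _ h)) hpos
      (hΔ.trans inf_le_left) ?_⟩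
    rw [sentVal_inst]
    exact Fml.relVal_congr _ _ φ hc (hΔ.trans (inf_le_right.trans inf_le_right))
  str1 s hs c d h :=
    union_mem_consistencyFamily_of_le hs trivial (BName.le_eqVal_symm (conjVal_le h))
  str2 s hs c d φ h hφ := by
    have hφL := (Fml.inL_subst _ _).1 (hs.2.1 _ hφ)
    refine union_mem_consistencyFamily_of_le hs ((Fml.inL_subst _ _).2 hφL) ?_
    have := conjVal_le hφ
    rw [sentVal_inst] at this ⊢
    exact Fml.relVal_congr _ _ φ (fun _ => BName.le_eqVal_symm (conjVal_le h)) this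
  str3 s hs d := ⟨d, union_mem_consistencyFamily_of_le hs trivial
    (le_top.trans (BName.eqVal_refl _).ge)⟩

/-- Every element of `B` is the Boolean value of an atomic sentence. -/
theorem exists_sentVal_eq (hκ : ℵ₀ ≤ κ) (b : B) :
    ∃ φ : Sentence (Names B κ), φ.InL lam ∧ sentVal B κ φ = b := by
  -- The sentence is `∅ ∈ {(∅, b)}`.
  let e : BName B := BName.ofFamily (ι := PEmpty) (fun i => i.elim) fun i => i.elim
  have he : e.HereditarilyLE κ := BName.hereditarilyLE_ofFamily (by simp) fun i => i.elim
  let c : BName B := BName.ofFamily (ι := PUnit) (fun _ => e) fun _ => b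
  have hc : c.HereditarilyLE κ :=
    BName.hereditarilyLE_ofFamily (by simpa using one_le_aleph0.trans hκ) fun _ => he
  refine ⟨Fml.mem (Tm.const ⟨e, he⟩) (Tm.const ⟨c, hc⟩), trivial, ?_⟩
  change BName.memVal e c = b
  rw [BName.memVal_ofFamily]
  simp

theorem isDenseEmbedding_piMap (hκ : ℵ₀ ≤ κ) : IsDenseEmbedding (piMap B κ lam) where
  monotone _ _ h := biInf_mono h
  incompatible_iff s t := by
    refine not_congr ⟨fun ⟨r, hs, ht⟩ => ⟨piMap B κ lam r, biInf_mono hs, biInf_mono ht⟩, ?_⟩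
    rintro ⟨r, hs, ht⟩
    -- The value of the union is the meet of the two values, which is nonzero as it lies above `r`.
    refine ⟨⟨s.1 ∪ t.1, s.2.1.union t.2.1, ?_, ?_⟩, Set.subset_union_left,
      Set.subset_union_right⟩
    · rintro φ (h | h)
      exacts [s.2.2.1 φ h, t.2.2.1 φ h]
    · rw [conjVal_union]
      exact r.2.trans_le (le_inf hs ht)
  dense b := by
    obtain ⟨φ, hφ, h⟩ := exists_sentVal_eq (lam := lam) hκ b.1
    have hv : conjVal B κ {φ} = b.1 := by rw [conjVal_singleton, h]
    refine ⟨⟨{φ}, Set.finite_singleton φ, ?_, ?_⟩, hv.le⟩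
    · rintro ψ rfl
      exact hφ
    · rw [hv]; exact b.2

end

/-! ### Boolean completions -/

theorem mem_compl_lowerSet {P : Type*} [Preorder P] {U : LowerSet P} {p : P} :
    p ∈ Uᶜ ↔ ∀ q ≤ p, q ∉ U := by
  have h : LowerSet.Iic p ≤ Uᶜ ↔ ∀ q ≤ p, q ∉ U := by
    rw [le_compl_iff_disjoint_right, disjoint_iff_inf_le]
    exact ⟨fun h q hq hU => h ⟨hq, hU⟩, fun h q hq => h q hq.1 hq.2⟩
  rw [← h]
  exact LowerSet.Iic_le.symm

theorem mem_compl_compl_lowerSet {P : Type*} [Preorder P] {U : LowerSet P} {p : P} :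
    p ∈ Uᶜᶜ ↔ ∀ q ≤ p, ∃ r ≤ q, r ∈ U := by
  simp only [mem_compl_lowerSet, not_forall, not_not, exists_prop]

theorem isRegular_lowerSet_iff {P : Type*} [Preorder P] {U : LowerSet P} :
    Heyting.IsRegular U ↔ ∀ p, (∀ q ≤ p, ∃ r ≤ q, r ∈ U) → p ∈ U :=
  ⟨fun h p hp => by rw [← h.eq]; exact mem_compl_compl_lowerSet.2 hp,
    fun h => le_antisymm (fun p hp => h p (mem_compl_compl_lowerSet.1 hp)) le_compl_compl⟩

/-- The isomorphism is preimage under `f`. Density of the image makes it preserve regularity and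
reflect the order; preservation of incompatibility makes it onto. -/
theorem IsDenseEmbedding.forcingEquivalent {P Q : Type*} [Preorder P] [Preorder Q] {f : P → Q}
    (hf : IsDenseEmbedding f) : ForcingEquivalent Q P := by
  have hcompat : ∀ {p q r}, r ≤ f p → r ≤ f q → ∃ s, s ≤ p ∧ s ≤ q := fun {p q r} h₁ h₂ =>
    not_not.1 (mt (hf.incompatible_iff p q).1 fun h => h ⟨r, h₁, h₂⟩)
  let pre (V : LowerSet Q) : LowerSet P := ⟨f ⁻¹' V, fun _ _ h ha => V.lower (hf.monotone h) ha⟩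
  have hpre : ∀ V : LowerSet Q, Heyting.IsRegular V → Heyting.IsRegular (pre V) := by
    refine fun V hV => isRegular_lowerSet_iff.2 fun p hp => ?_
    refine isRegular_lowerSet_iff.1 hV _ fun q hq => ?_
    obtain ⟨a, ha⟩ := hf.dense q
    obtain ⟨s, hsa, hsp⟩ := hcompat le_rfl (ha.trans hq)
    obtain ⟨r, hrs, hr⟩ := hp s hsp
    exact ⟨f r, (hf.monotone (hrs.trans hsa)).trans ha, hr⟩
  let g : RO Q ↪o RO P := OrderEmbedding.ofMapLEIff (fun V => ⟨pre V.1, hpre V.1 V.2⟩) fun V W =>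
    ⟨fun h v hv => isRegular_lowerSet_iff.1 W.2 v fun q hq => by
      obtain ⟨a, ha⟩ := hf.dense q
      exact ⟨f a, ha, h (show f a ∈ V.1 from V.1.lower (ha.trans hq) hv)⟩, fun h p hp => h hp⟩
  refine ⟨RelIso.ofSurjective g fun U => ?_⟩
  -- The preimage of `U` is the regularization of the downward closure of its image.
  refine ⟨⟨(lowerClosure (f '' U.1))ᶜᶜ, Heyting.isRegular_compl _⟩, Subtype.ext ?_⟩
  refine le_antisymm (fun p hp => isRegular_lowerSet_iff.1 U.2 p fun q hq => ?_) fun p hp => ?_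
  · obtain ⟨r, hr, _, ⟨u, hu, rfl⟩, hru⟩ := mem_compl_compl_lowerSet.1 hp (f q) (hf.monotone hq)
    obtain ⟨s, hsq, hsu⟩ := hcompat hr hru
    exact ⟨s, hsq, U.1.lower hsu hu⟩
  · have : lowerClosure (f '' U.1) ≤ (lowerClosure (f '' U.1))ᶜᶜ := le_compl_compl
    exact this (subset_lowerClosure (Set.mem_image_of_mem f hp))

/-- The regular elements of a complete Heyting algebra form a complete Boolean algebra. -/
noncomputable instance instCompleteBooleanAlgebraRegular {α : Type*} [Order.Frame α] :
    CompleteBooleanAlgebra (Heyting.Regular α) :=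
  { (inferInstance : BooleanAlgebra (Heyting.Regular α)) with
    sSup := (Heyting.Regular.gi (α := α)).liftCompleteLattice.sSup
    sInf := (Heyting.Regular.gi (α := α)).liftCompleteLattice.sInf
    isLUB_sSup := (Heyting.Regular.gi (α := α)).liftCompleteLattice.isLUB_sSup
    isGLB_sInf := (Heyting.Regular.gi (α := α)).liftCompleteLattice.isGLB_sInf }

theorem mem_toRegular_Iic {P : Type*} [Preorder P] {p q : P} :
    q ∈ (Heyting.Regular.toRegular (LowerSet.Iic p)).1 ↔ ∀ r ≤ q, ∃ s ≤ r, s ≤ p :=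
  mem_compl_compl_lowerSet

theorem bot_lt_regular_iff {P : Type*} [Preorder P] {U : RO P} : ⊥ < U ↔ ∃ p, p ∈ U.1 := by
  rw [bot_lt_iff_ne_bot]
  constructor
  · intro h
    by_contra! H
    exact h (Subtype.ext (le_bot_iff.1 fun p hp => (H p hp).elim))
  · rintro ⟨p, hp⟩ rfl
    exact hp

/-- The canonical map of a forcing notion to the positive elements of its completion. -/
def toPosRO {P : Type*} [Preorder P] (p : P) : Pos (RO P) :=
  ⟨Heyting.Regular.toRegular (LowerSet.Iic p),
    bot_lt_regular_iff.2 ⟨p, mem_toRegular_Iic.2 fun r hr => ⟨r, le_rfl, hr⟩⟩⟩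

theorem toPosRO_le_iff {P : Type*} [Preorder P] {p : P} {U : Pos (RO P)} :
    toPosRO p ≤ U ↔ p ∈ U.1.1 :=
  (Heyting.Regular.gi.gc (LowerSet.Iic p) U.1).trans LowerSet.Iic_le

theorem exists_toPosRO_le {P : Type*} [Preorder P] (U : Pos (RO P)) : ∃ p, toPosRO p ≤ U :=
  (bot_lt_regular_iff.1 U.2).imp fun _ => toPosRO_le_iff.2

/-- This is the order of the separative quotient, in general weaker than `p ≤ q`. -/
theorem toPosRO_le_toPosRO_iff {P : Type*} [Preorder P] {p q : P} :
    toPosRO p ≤ toPosRO q ↔ ∀ r ≤ p, ∃ s ≤ r, s ≤ q :=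
  toPosRO_le_iff.trans mem_toRegular_Iic

theorem isDenseEmbedding_toPosRO (P : Type*) [Preorder P] :
    IsDenseEmbedding (toPosRO : P → Pos (RO P)) := by
  have mono : Monotone (toPosRO : P → Pos (RO P)) := fun _ _ h =>
    toPosRO_le_toPosRO_iff.2 fun r hr => ⟨r, le_rfl, hr.trans h⟩
  refine ⟨mono, fun p q => not_congr ⟨?_, ?_⟩, exists_toPosRO_le⟩
  · rintro ⟨r, hp, hq⟩
    exact ⟨toPosRO r, mono hp, mono hq⟩
  · rintro ⟨U, hp, hq⟩
    -- Extensions below `p` and below `q` are both dense under `a`, so two successive extensions of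
    -- `a` give a common lower bound.
    obtain ⟨a, ha⟩ := exists_toPosRO_le U
    obtain ⟨b, hba, hbp⟩ := toPosRO_le_toPosRO_iff.1 (ha.trans hp) a le_rfl
    obtain ⟨c, hcb, hcq⟩ := toPosRO_le_toPosRO_iff.1 (ha.trans hq) b hba
    exact ⟨c, hcb.trans hbp, hcq⟩

theorem ForcingEquivalent.trans {P Q R : Type*} [Preorder P] [Preorder Q] [Preorder R]
    (h : ForcingEquivalent P Q) (h' : ForcingEquivalent Q R) : ForcingEquivalent P R :=
  ⟨h.some.trans h'.some⟩

theorem ForcingEquivalent.symm {P Q : Type*} [Preorder P] [Preorder Q]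
    (h : ForcingEquivalent P Q) : ForcingEquivalent Q P :=
  ⟨h.some.symm⟩

end ForcingConsistency

theorem mainTheorem5 :
    (∀ (B : Type u) [CompleteBooleanAlgebra B] (κ lam : Cardinal.{u}),
      ℵ₀ ≤ κ → #B ≤ κ → lam.IsRegular →
        ForcingConsistency.IsConsistencyProperty
            (ForcingConsistency.consistencyFamily B κ lam) ∧
          ForcingConsistency.IsDenseEmbedding (ForcingConsistency.piMap B κ lam) ∧
          ForcingConsistency.ForcingEquivalent (ForcingConsistency.Pos B)
            (ForcingConsistency.Cond (ForcingConsistency.consistencyFamily B κ lam))) ∧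
      (∀ (P : Type u) [Preorder P] (lam : Cardinal.{u}), lam.IsRegular →
        ∃ (B : Type u) (_ : CompleteBooleanAlgebra B) (κ : Cardinal.{u}),
          ℵ₀ ≤ κ ∧ #B ≤ κ ∧
            ForcingConsistency.IsConsistencyProperty
              (ForcingConsistency.consistencyFamily B κ lam) ∧
            ForcingConsistency.ForcingEquivalent P
              (ForcingConsistency.Cond (ForcingConsistency.consistencyFamily B κ lam))) := by

  open ForcingConsistency in
  refine ⟨fun B _ κ lam hκ hB _ => ⟨isConsistencyProperty_consistencyFamily hκ hB,
    isDenseEmbedding_piMap hκ, (isDenseEmbedding_piMap hκ).forcingEquivalent⟩,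
    -- The maximum with `ℵ₀` covers finite completions.
    fun P _ lam _ => ⟨RO P, inferInstance, max ℵ₀ #(RO P), le_max_left _ _, le_max_right _ _,
      isConsistencyProperty_consistencyFamily (le_max_left _ _) (le_max_right _ _), ?_⟩⟩
  exact (isDenseEmbedding_toPosRO P).forcingEquivalent.symm.trans
    (isDenseEmbedding_piMap (le_max_left _ _)).forcingEquivalent
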